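/- Let $n\ge 1$ be an integer, let $k>0$ and $\phi,\theta$ be real numbers, and let $N\ge 0$ be an integer. Write $(x)_j=x(x+1)\cdots(x+j-1)$ for the Pochhammer symbol, $b^{\theta,n}_s=\cos(\theta+2\pi s/n)$ for $s=1,\dots,n$, and $$C_j^{(k)}(x)=\sum_{0\le l\le j/2}(-1)^l\frac{(k)_{j-l}}{l!\,(j-2l)!}(2x)^{j-2l}$$ for the Gegenbauer polynomials. Put $$S_N(n,k,\phi,\theta)=\sum_{\substack{j,m\ge 0\\ 2m+nj=N}}\frac{n(j+k)}{m!\,\Gamma(n(j+k)+m+1)}\,\frac{C_j^{(k)}(\cos n\phi)\,C_j^{(k)}(\cos n\theta)}{C_j^{(k)}(1)}.$$ Then $$S_N(n,k,\phi,\theta)=\frac{2^N}{\Gamma(nk+N)}\sum_{\substack{m_1,\dots,m_n\ge 0\\ m_1+\dots+m_n=N}}\ \sum_{j=0}^{\min(m_1,\dots,m_n)}\frac{(k)_j(k)_j}{(2k)_j\,j!}\bigl(-2^{2-n}\sin(n\theta)\sin(n\phi)\bigr)^j\prod_{s=1}^n\frac{(k+j)_{m_s-j}}{(m_s-j)!}\bigl(b^{\theta-\phi,n}_s\bigr)^{m_s-j}.$$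 In particular, for $\phi=0$, $$S_N(n,k,0,\theta)=\frac{2^N}{\Gamma(nk+N)}\sum_{\substack{m_1,\dots,m_n\ge 0\\ m_1+\dots+m_n=N}}\ \prod_{s=1}^n(k)_{m_s}\frac{\bigl(b^{\theta,n}_s\bigr)^{m_s}}{m_s!}.$$ -/

import Mathlib

noncomputable section

namespace DihedralGegenbauer

/-- The Pochhammer symbol `(x)_j = x (x + 1) ⋯ (x + j - 1)`. -/
def poch (x : ℝ) (j : ℕ) : ℝ := (ascPochhammer ℝ j).eval x

/-- The (non-normalized) Gegenbauer polynomial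
`C_j^{(k)}(X) = ∑_{0 ≤ 2l ≤ j} (-1)^l (k)_{j-l} / (l! (j-2l)!) (2X)^{j-2l}`. -/
def gegenbauer (k : ℝ) (j : ℕ) : Polynomial ℝ :=
  ∑ l ∈ Finset.range (j / 2 + 1),
    Polynomial.C ((-1) ^ l * poch k (j - l) / ((l.factorial : ℝ) * ((j - 2 * l).factorial : ℝ))) *
      (2 * Polynomial.X) ^ (j - 2 * l)

/-- The pairs `(j, m)` of natural numbers with `2 m + n j = N`; for `n ≥ 1` every such pair has
`j, m ≤ N`, so nothing is lost by the bounds. -/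
def indexPairs (N n : ℕ) : Finset (ℕ × ℕ) :=
  (Finset.range (N + 1) ×ˢ Finset.range (N + 1)).filter fun p => 2 * p.2 + n * p.1 = N

/-- The finite sum `S_N(n, k, φ, θ)`. -/
def S (N n : ℕ) (k φ θ : ℝ) : ℝ :=
  ∑ p ∈ indexPairs N n,
    (n : ℝ) * ((p.1 : ℝ) + k) /
        ((p.2.factorial : ℝ) * Real.Gamma ((n : ℝ) * ((p.1 : ℝ) + k) + (p.2 : ℝ) + 1)) *
      ((gegenbauer k p.1).eval (Real.cos (n * φ)) * (gegenbauer k p.1).eval (Real.cos (n * θ)) /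
        (gegenbauer k p.1).eval 1)

/-- `b_s^{θ,n} = cos (θ + 2 π s / n)`. -/
def b (θ : ℝ) (n s : ℕ) : ℝ := Real.cos (θ + 2 * Real.pi * (s : ℝ) / (n : ℝ))

end DihedralGegenbauer

end

/-!
Let `c = 1 + X² c²` be the Catalan series and put `W = (X c)ⁿ`. Since
`(1 - 2 b X) c = 1 - 2 b (X c) + (X c)²`, the factorization of `1 - 2 cos(n α) zⁿ + z²ⁿ` into the
`n` factors `1 - 2 bₛ z + z²` gives `∏ₛ (1 - 2 bₛ X) · cⁿ = 1 - 2 cos(n α) W + W²`. Raising this to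
the power `-κ` for a natural number `κ` and comparing coefficients of `X ^ N` expresses the
coefficients of `∏ₛ (1 - 2 bₛ X)^(-κ)` by the Gegenbauer polynomials at `cos(n α)` and the
coefficients `a Γ(a + 2m) / (m! Γ(a + m + 1))` of the powers of `c`, which are those of `S`. Both
sides are polynomials in `κ`, so `κ` may be real, and this is the case `φ = 0`.

The general case reduces to it, with `κ = k + j`, by the formula writing
`C_j(cos A) C_j(cos B) / C_j(1)` as a combination of the `C_{j-i}^{(κ+i)}(cos (A - B))`. As
functions of `A`, both sides of that formula solve the Gegenbauer equation
`f'' + 2κ cot A f' + μ f = 0`, which has, up to a scalar, only one solution that is analytic at its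
singular point `A = 0`.
-/

noncomputable section

namespace DihedralGegenbauer

section Pochhammer

@[simp]
lemma poch_zero (x : ℝ) : poch x 0 = 1 := by simp [poch]

lemma poch_succ (x : ℝ) (j : ℕ) : poch x (j + 1) = poch x j * (x + j) :=
  ascPochhammer_succ_eval j x

lemma poch_succ_left (x : ℝ) (j : ℕ) : poch x (j + 1) = x * poch (x + 1) j := by
  simp [poch, ascPochhammer_succ_left]

lemma poch_ne_zero {x : ℝ} (hx : ∀ i : ℕ, x ≠ -i) (j : ℕ) : poch x j ≠ 0 := by
  induction j with
  | zero => simp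
  | succ j ih => exact poch_succ x j ▸ mul_ne_zero ih (by simpa [add_eq_zero_iff_eq_neg] using hx j)

-- `Real.Gamma` is `0` at its poles, so that its inverse is the entire function `1 / Γ`.
lemma inv_Gamma_eq_poch_div (x : ℝ) (j : ℕ) :
    (Real.Gamma x)⁻¹ = poch x j / Real.Gamma (x + j) := by
  have step (y : ℝ) : (Real.Gamma y)⁻¹ = y / Real.Gamma (y + 1) := by
    rcases eq_or_ne y 0 with rfl | hy
    · simp
    · rw [Real.Gamma_add_one hy, div_mul_cancel_left₀ hy]
  induction j with
  | zero => simp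
  | succ j ih =>
    rw [ih, poch_succ, div_eq_mul_inv, step, Nat.cast_succ, add_assoc]
    ring

end Pochhammer

section GegenbauerPolynomials

open Polynomial Finset

lemma gegenbauer_eq_sum_antidiagonal (κ : ℝ) (j : ℕ) :
    gegenbauer κ j = ∑ p ∈ antidiagonal j, C
      ((-1) ^ p.1 * poch κ p.2 / p.2.factorial * p.2.choose p.1) *
        (2 * X) ^ (p.2 - p.1) := by
  rw [Nat.sum_antidiagonal_eq_sum_range_succ_mk, gegenbauer]
  refine sum_subset_zero_on_sdiff (range_mono (by omega)) (fun l hl => ?_) fun l hl => ?_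
  · rw [mem_sdiff, mem_range, mem_range] at hl
    simp [Nat.choose_eq_zero_of_lt (show j - l < l by omega)]
  · rw [mem_range] at hl
    rw [Nat.cast_choose ℝ (show l ≤ j - l by omega), show j - l - l = j - 2 * l by omega]
    congr 2
    field_simp

@[simp]
lemma gegenbauer_zero (κ : ℝ) : gegenbauer κ 0 = 1 := by
  simp [gegenbauer_eq_sum_antidiagonal]

lemma derivative_two_mul_X_pow (r : ℕ) :
    derivative ((2 * X : ℝ[X]) ^ r) = C (2 * r : ℝ) * (2 * X) ^ (r - 1) := by
  rw [derivative_pow, show (2 * X : ℝ[X]) = C 2 * X from rfl, derivative_C_mul_X, C_mul]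
  ring

lemma derivative_gegenbauer_succ (κ : ℝ) (j : ℕ) :
    derivative (gegenbauer κ (j + 1)) = C (2 * κ) * gegenbauer (κ + 1) j := by
  simp only [gegenbauer_eq_sum_antidiagonal]
  rw [Nat.sum_antidiagonal_succ', derivative_add, derivative_sum, mul_sum, Nat.zero_sub, pow_zero,
    mul_one, derivative_C, zero_add]
  refine sum_congr rfl fun ⟨l, r⟩ _ => ?_
  have hchoose : (r.choose l : ℝ) * (r + 1) = (r + 1).choose l * (r + 1 - l : ℕ) :=
    mod_cast Nat.choose_mul_succ_eq r l
  rw [derivative_C_mul, derivative_two_mul_X_pow, ← mul_assoc, ← mul_assoc, ← C_mul, ← C_mul,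
    Nat.sub_right_comm, Nat.add_sub_cancel, poch_succ_left, Nat.factorial_succ, Nat.cast_mul,
    Nat.cast_succ]
  congr 2
  field_simp
  linear_combination (-κ * poch (κ + 1) r) * hchoose

lemma iterate_derivative_gegenbauer (κ : ℝ) (i j : ℕ) :
    derivative^[i] (gegenbauer κ (i + j)) = C (2 ^ i * poch κ i) * gegenbauer (κ + i) j := by
  induction i generalizing κ with
  | zero => simp
  | succ i ih =>
    rw [Function.iterate_succ_apply, show i + 1 + j = i + j + 1 by ring,
      derivative_gegenbauer_succ, iterate_derivative_C_mul, ih, ← mul_assoc, ← C_mul,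
      poch_succ_left, Nat.cast_succ, show κ + 1 + (i : ℝ) = κ + (i + 1) by ring]
    congr 2
    ring

lemma iterate_derivative_gegenbauer_eq_zero (κ : ℝ) {i j : ℕ} (h : j < i) :
    derivative^[i] (gegenbauer κ j) = 0 := by
  obtain ⟨d, rfl⟩ := Nat.exists_eq_add_of_lt h
  have hconst := iterate_derivative_gegenbauer κ j 0
  rw [add_zero, gegenbauer_zero, mul_one] at hconst
  rw [show j + d + 1 = (d + 1) + j by ring, Function.iterate_add_apply, hconst,
    iterate_derivative_C (Nat.succ_pos d)]

end GegenbauerPolynomials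

section GeneratingFunction

open PowerSeries Finset

/-- The power series of `(1 - y X) ^ (-κ)`. -/
def binomSeries (κ y : ℝ) : ℝ⟦X⟧ := rescale (-y) (PowerSeries.binomialSeries ℝ (-κ))

lemma coeff_binomSeries (κ y : ℝ) (m : ℕ) :
    coeff m (binomSeries κ y) = poch κ m / m.factorial * y ^ m := by
  have hpoch : m.factorial * Ring.choose (κ + m - 1) m = poch κ m := by
    rw [← Ring.multichoose_eq, ← nsmul_eq_mul, Ring.factorial_nsmul_multichoose_eq_ascPochhammer,
      Polynomial.ascPochhammer_smeval_eq_eval, poch]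
  rw [binomSeries, coeff_rescale, binomialSeries_coeff, Ring.choose_neg, ← hpoch,
    mul_div_cancel_left₀ _ (by positivity), neg_pow, Int.negOnePow_def, zpow_natCast,
    Units.smul_def]
  simp only [Units.val_pow_eq_pow_val, Units.val_neg, Units.val_one, zsmul_eq_mul, Int.cast_pow,
    Int.cast_neg, Int.cast_one, smul_eq_mul, mul_one]
  linear_combination Ring.choose (κ + m - 1) m * y ^ m * (even_two_mul m).neg_one_pow (α := ℝ)

lemma one_sub_mul_binomSeries (κ y : ℝ) :
    (1 - C y * X) * binomSeries (κ + 1) y = binomSeries κ y := by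
  have h : (1 + X) * PowerSeries.binomialSeries ℝ (-(κ + 1)) =
      PowerSeries.binomialSeries ℝ (-κ) := by
    rw [← pow_one (1 + X : ℝ⟦X⟧), ← binomialSeries_nat (R := ℝ), ← binomialSeries_add]
    congr 1
    simp
  simpa [binomSeries, rescale_X, sub_eq_add_neg] using congrArg (rescale (-y)) h

lemma one_sub_pow_mul_binomSeries (κ : ℕ) (y : ℝ) :
    (1 - C y * X) ^ κ * binomSeries κ y = 1 := by
  have h : (1 + X) ^ κ * PowerSeries.binomialSeries ℝ (-κ : ℝ) = 1 := by
    rw [← binomialSeries_nat (R := ℝ), ← binomialSeries_add, add_neg_cancel, binomialSeries_zero]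
  simpa [binomSeries, rescale_X, sub_eq_add_neg] using congrArg (rescale (-y)) h

lemma derivative_binomSeries (κ y : ℝ) :
    d⁄dX ℝ (binomSeries κ y) = C (κ * y) * binomSeries (κ + 1) y := by
  ext m
  rw [coeff_derivative, coeff_C_mul, coeff_binomSeries, coeff_binomSeries, poch_succ_left,
    Nat.factorial_succ]
  push_cast
  field_simp
  ring

/-- The generating function `∑ C_j^{(κ)}(x) T^j` of the Gegenbauer polynomials. -/
def gegenbauerSeries (κ x : ℝ) : ℝ⟦X⟧ := mk fun j => (gegenbauer κ j).eval x

lemma coeff_gegenbauerSeries (κ x : ℝ) (j : ℕ) :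
    coeff j (gegenbauerSeries κ x) = (gegenbauer κ j).eval x := coeff_mk _ _

lemma hasSubst_two_mul_X_sub_X_sq (x : ℝ) : HasSubst (C (2 * x) * X - X ^ 2 : ℝ⟦X⟧) :=
  .of_constantCoeff_zero' (by simp)

lemma coeff_mul_subst {W : ℝ⟦X⟧} (hW : X ∣ W) (f H : ℝ⟦X⟧) (N : ℕ) :
    coeff N (f * H.subst W) = ∑ l ∈ range (N + 1), coeff l H * coeff N (f * W ^ l) := by
  have hs : HasSubst W := HasSubst.of_constantCoeff_zero' (X_dvd_iff.1 hW)
  have htail : coeff N (f * (W ^ (N + 1) * (mk fun i => coeff (i + (N + 1)) H).subst W)) = 0 :=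
    X_pow_dvd_iff.1 (((pow_dvd_pow_of_dvd hW _).mul_right _).mul_left _) N (Nat.lt_succ_self N)
  conv_lhs => rw [eq_X_pow_mul_shift_add_trunc (N + 1) H]
  rw [subst_add hs, subst_mul hs, subst_pow hs, subst_X hs, mul_add, map_add, htail, zero_add,
    subst_coe hs, trunc_apply, map_sum, mul_sum, map_sum, Nat.Ico_zero_eq_range]
  refine sum_congr rfl fun l _ => ?_
  rw [Polynomial.aeval_monomial, mul_left_comm, PowerSeries.algebraMap_apply, coeff_C_mul,
    Algebra.algebraMap_self, RingHom.id_apply]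

lemma coeff_two_mul_X_sub_X_sq_pow (x : ℝ) (l r : ℕ) :
    coeff (l + r) ((C (2 * x) * X - X ^ 2 : ℝ⟦X⟧) ^ r) =
      (-1) ^ l * ((2 * x) ^ (r - l) * r.choose l) := by
  have hC : rescale (-1) (C (2 * x)) = C (2 * x) := by
    ext m
    cases m <;> simp [coeff_rescale, coeff_C, -map_mul]
  have h : (C (2 * x) * X - X ^ 2 : ℝ⟦X⟧) ^ r = X ^ r *
      rescale (-1 : ℝ) ((Polynomial.X + Polynomial.C (2 * x)) ^ r : Polynomial ℝ) := by
    simp only [Polynomial.coe_pow, Polynomial.coe_add, Polynomial.coe_X, Polynomial.coe_C, map_pow,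
      map_add, rescale_X, map_neg, map_one, hC, ← mul_pow]
    ring
  rw [h, coeff_X_pow_mul, coeff_rescale, Polynomial.coeff_coe, Polynomial.coeff_X_add_C_pow]

lemma gegenbauerSeries_eq_subst (κ x : ℝ) :
    gegenbauerSeries κ x = (binomSeries κ 1).subst (C (2 * x) * X - X ^ 2 : ℝ⟦X⟧) := by
  ext j
  rw [← one_mul (subst _ _), coeff_mul_subst ⟨C (2 * x) - X, by ring⟩,
    ← Nat.sum_antidiagonal_eq_sum_range_succ_mk fun p => coeff p.1 (binomSeries κ 1) *
      coeff j (1 * (C (2 * x) * X - X ^ 2) ^ p.1),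
    ← Nat.sum_antidiagonal_swap, coeff_gegenbauerSeries, gegenbauer_eq_sum_antidiagonal,
    Polynomial.eval_finsetSum]
  refine sum_congr rfl fun p hp => ?_
  rw [one_mul, ← mem_antidiagonal.1 hp, Prod.fst_swap, coeff_two_mul_X_sub_X_sq_pow,
    coeff_binomSeries]
  simp only [Polynomial.eval_mul, Polynomial.eval_C, Polynomial.eval_pow, Polynomial.eval_X,
    Polynomial.eval_ofNat, one_pow]
  ring

lemma subst_one_sub_C_one_mul_X (x : ℝ) :
    (1 - C 1 * X : ℝ⟦X⟧).subst (C (2 * x) * X - X ^ 2 : ℝ⟦X⟧) = 1 - C (2 * x) * X + X ^ 2 := by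
  have hs := hasSubst_two_mul_X_sub_X_sq x
  rw [map_one, one_mul, ← coe_substAlgHom hs, map_sub, map_one, substAlgHom_X]
  ring

lemma mul_gegenbauerSeries (κ x : ℝ) :
    (1 - C (2 * x) * X + X ^ 2) * gegenbauerSeries (κ + 1) x = gegenbauerSeries κ x := by
  rw [gegenbauerSeries_eq_subst, gegenbauerSeries_eq_subst, ← subst_one_sub_C_one_mul_X,
    ← subst_mul (hasSubst_two_mul_X_sub_X_sq x), one_sub_mul_binomSeries]

lemma pow_mul_gegenbauerSeries (κ : ℕ) (x : ℝ) :
    (1 - C (2 * x) * X + X ^ 2) ^ κ * gegenbauerSeries κ x = 1 := by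
  have hs := hasSubst_two_mul_X_sub_X_sq x
  rw [gegenbauerSeries_eq_subst, ← subst_one_sub_C_one_mul_X, ← subst_pow hs, ← subst_mul hs,
    one_sub_pow_mul_binomSeries, ← coe_substAlgHom hs, map_one]

lemma derivative_gegenbauerSeries (κ x : ℝ) :
    d⁄dX ℝ (gegenbauerSeries κ x) = C (2 * κ) * (C x - X) * gegenbauerSeries (κ + 1) x := by
  have hs := hasSubst_two_mul_X_sub_X_sq x
  have hC : (C κ : ℝ⟦X⟧).subst (C (2 * x) * X - X ^ 2 : ℝ⟦X⟧) = C κ := subst_C κ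
  have hW : d⁄dX ℝ (C (2 * x) * X - X ^ 2 : ℝ⟦X⟧) = 2 * (C x - X) := by
    rw [map_sub, Derivation.leibniz, derivative_C, derivative_X, derivative_pow, derivative_X,
      map_mul, map_ofNat, smul_zero, smul_eq_mul, pow_one, Nat.cast_ofNat]
    ring
  rw [gegenbauerSeries_eq_subst, gegenbauerSeries_eq_subst, derivative_subst hs, hW,
    derivative_binomSeries, mul_one, subst_mul hs, hC, map_mul C 2 κ, map_ofNat]
  ring

end GeneratingFunction

section DifferentialEquation

open Polynomial

lemma coeff_X_mul_gegenbauerSeries (κ x : ℝ) (j : ℕ) :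
    2 * κ * PowerSeries.coeff j (PowerSeries.X * gegenbauerSeries (κ + 1) x) =
      (derivative (gegenbauer κ j)).eval x := by
  cases j with
  | zero => simp
  | succ j =>
    rw [PowerSeries.coeff_succ_X_mul, derivative_gegenbauer_succ, eval_mul, eval_C,
      coeff_gegenbauerSeries]

lemma succ_mul_gegenbauer_succ (κ : ℝ) (j : ℕ) :
    C (j + 1 : ℝ) * gegenbauer κ (j + 1) =
      X * derivative (gegenbauer κ (j + 1)) - derivative (gegenbauer κ j) := by
  refine Polynomial.funext fun x => ?_
  have h := congrArg (PowerSeries.coeff j) (derivative_gegenbauerSeries κ x)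
  rw [PowerSeries.coeff_derivative, mul_assoc, PowerSeries.coeff_C_mul, sub_mul, map_sub,
    PowerSeries.coeff_C_mul, coeff_gegenbauerSeries,
    ← PowerSeries.coeff_succ_X_mul j (gegenbauerSeries (κ + 1) x)] at h
  simp only [eval_mul, eval_sub, eval_C, eval_X]
  linear_combination h + x * coeff_X_mul_gegenbauerSeries κ x (j + 1) -
    coeff_X_mul_gegenbauerSeries κ x j

lemma add_mul_gegenbauer (κ : ℝ) (j : ℕ) :
    C (2 * κ + j) * gegenbauer κ j =
      derivative (gegenbauer κ (j + 1)) - X * derivative (gegenbauer κ j) := by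
  rcases j with _ | j
  · simp [derivative_gegenbauer_succ]
  refine Polynomial.funext fun x => ?_
  have hladder := congrArg (eval x) (succ_mul_gegenbauer_succ κ j)
  have h := congrArg (PowerSeries.coeff (j + 1)) (mul_gegenbauerSeries κ x)
  rw [add_mul, sub_mul, one_mul, mul_assoc, map_add, map_sub, PowerSeries.coeff_C_mul, pow_two,
    mul_assoc PowerSeries.X, PowerSeries.coeff_succ_X_mul _ (_ * _), coeff_gegenbauerSeries,
    coeff_gegenbauerSeries] at h
  rw [derivative_gegenbauer_succ κ (j + 1)]
  simp only [eval_mul, eval_sub, eval_C, eval_X, Nat.cast_add, Nat.cast_one] at hladder ⊢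
  linear_combination hladder - 2 * κ * h -
    2 * x * coeff_X_mul_gegenbauerSeries κ x (j + 1) + coeff_X_mul_gegenbauerSeries κ x j

lemma one_sub_X_sq_mul_derivative_gegenbauer (κ : ℝ) (j : ℕ) :
    (1 - X ^ 2) * derivative (gegenbauer κ (j + 1)) =
      C (2 * κ + j) * gegenbauer κ j - C (j + 1 : ℝ) * X * gegenbauer κ (j + 1) := by
  linear_combination X * succ_mul_gegenbauer_succ κ j - add_mul_gegenbauer κ j

lemma gegenbauer_eval_one (κ : ℝ) (j : ℕ) :
    (gegenbauer κ j).eval 1 = poch (2 * κ) j / j.factorial := by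
  induction j with
  | zero => simp
  | succ j ih =>
    have h := congrArg (eval 1) (one_sub_X_sq_mul_derivative_gegenbauer κ j)
    simp only [eval_mul, eval_sub, eval_one, eval_pow, eval_X, eval_C, one_pow, sub_self, zero_mul,
      mul_one, ih] at h
    rw [poch_succ, Nat.factorial_succ, Nat.cast_mul, Nat.cast_succ]
    field_simp at h ⊢
    linear_combination h

lemma gegenbauer_eval_one_ne_zero {κ : ℝ} (hκ : ∀ i : ℕ, 2 * κ ≠ -i) (j : ℕ) :
    (gegenbauer κ j).eval 1 ≠ 0 := by
  rw [gegenbauer_eval_one]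
  exact div_ne_zero (poch_ne_zero hκ j) (by positivity)

/-- `P` solves the Gegenbauer differential equation with parameter `κ` and eigenvalue `μ`. -/
def IsGegenbauerSol (κ μ : ℝ) (P : ℝ[X]) : Prop :=
  (1 - X ^ 2) * derivative (derivative P) - C (2 * κ + 1) * X * derivative P + C μ * P = 0

lemma isGegenbauerSol_gegenbauer (κ : ℝ) (j : ℕ) :
    IsGegenbauerSol κ (j * (j + 2 * κ)) (gegenbauer κ j) := by
  rcases j with _ | j
  · simp [IsGegenbauerSol]
  have h := congrArg derivative (one_sub_X_sq_mul_derivative_gegenbauer κ j)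
  simp only [derivative_mul, derivative_sub, derivative_one, derivative_X_pow, derivative_C,
    derivative_X, Nat.cast_ofNat, C_ofNat, zero_mul, zero_sub, zero_add, mul_one] at h
  have hladder := succ_mul_gegenbauer_succ κ j
  rw [IsGegenbauerSol]
  simp only [Nat.cast_add, Nat.cast_one, C_add, C_mul, C_1, C_ofNat] at h hladder ⊢
  linear_combination h + (2 * C κ + C (j : ℝ)) * hladder

lemma IsGegenbauerSol.iterate {κ μ : ℝ} {P : ℝ[X]} (h : IsGegenbauerSol κ μ P) (i : ℕ) :
    IsGegenbauerSol (κ + i) (μ - i * (2 * κ + i)) (derivative^[i] P) := by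
  induction i with
  | zero => simpa using h
  | succ i ih =>
    have hderiv := congrArg derivative ih
    rw [IsGegenbauerSol, Function.iterate_succ_apply']
    simp only [derivative_add, derivative_sub, derivative_mul, derivative_C, derivative_X,
      derivative_X_pow, derivative_one, derivative_zero, derivative_ofNat, C_add, C_mul, C_sub,
      C_1, C_ofNat, Nat.cast_add, Nat.cast_one, Nat.cast_ofNat] at hderiv ⊢
    linear_combination hderiv

end DifferentialEquation

section TrigonometricOperator

open Filter Topology Polynomial
open scoped ContDiff

/-- The derivation `sin A * d/dA`. Being regular at `0` it turns `sin ^ i * f` into another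
function of this form, without the exponents `i - 1`, `i - 2` of ordinary derivatives. -/
def sinDeriv (f : ℝ → ℝ) (A : ℝ) : ℝ := Real.sin A * deriv f A

/-- The Gegenbauer operator `f'' + 2κ cot A f' + μ f` in the variable `A`, multiplied by `sin² A`
and written with `sinDeriv`. -/
def gegenbauerOp (κ μ : ℝ) (f : ℝ → ℝ) (A : ℝ) : ℝ :=
  sinDeriv (sinDeriv f) A + (2 * κ - 1) * Real.cos A * sinDeriv f A + μ * Real.sin A ^ 2 * f A

lemma contDiff_sinDeriv {f : ℝ → ℝ} (hf : ContDiff ℝ ω f) : ContDiff ℝ ω (sinDeriv f) :=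
  Real.contDiff_sin.mul hf.deriv'

lemma sinDeriv_sum_mul {ι : Type*} (s : Finset ι) (c : ι → ℝ) {f : ι → ℝ → ℝ}
    (hf : ∀ i, Differentiable ℝ (f i)) :
    sinDeriv (fun A => ∑ i ∈ s, c i * f i A) = fun A => ∑ i ∈ s, c i * sinDeriv (f i) A := by
  funext A
  rw [sinDeriv, deriv_fun_sum fun i _ => (hf i A).const_mul (c i), Finset.mul_sum]
  refine Finset.sum_congr rfl fun i _ => ?_
  rw [deriv_const_mul _ (hf i A), sinDeriv]
  ring

lemma gegenbauerOp_sum_mul (κ μ : ℝ) {ι : Type*} (s : Finset ι) (c : ι → ℝ) {f : ι → ℝ → ℝ}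
    (hf : ∀ i, ContDiff ℝ ω (f i)) (A : ℝ) :
    gegenbauerOp κ μ (fun A => ∑ i ∈ s, c i * f i A) A =
      ∑ i ∈ s, c i * gegenbauerOp κ μ (f i) A := by
  simp only [gegenbauerOp, sinDeriv_sum_mul s c fun i => (hf i).differentiable (by simp),
    sinDeriv_sum_mul s c fun i => (contDiff_sinDeriv (hf i)).differentiable (by simp),
    Finset.mul_sum, ← Finset.sum_add_distrib]
  exact Finset.sum_congr rfl fun i _ => by ring

lemma gegenbauerOp_mul_sub_mul (κ μ c d : ℝ) {f g : ℝ → ℝ} (hf : ContDiff ℝ ω f)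
    (hg : ContDiff ℝ ω g) (A : ℝ) :
    gegenbauerOp κ μ (fun A => c * f A - d * g A) A =
      c * gegenbauerOp κ μ f A - d * gegenbauerOp κ μ g A := by
  have h := gegenbauerOp_sum_mul κ μ Finset.univ ![c, -d] (f := ![f, g])
    (Fin.forall_fin_two.2 ⟨hf, hg⟩) A
  simpa [Fin.sum_univ_two, ← sub_eq_add_neg] using h

lemma exists_sinDeriv_eventuallyEq_pow_mul {f g : ℝ → ℝ} {m : ℕ} (hg : AnalyticAt ℝ g 0)
    (hf : f =ᶠ[𝓝 0] fun A => A ^ m * g A) :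
    ∃ g₁ : ℝ → ℝ, AnalyticAt ℝ g₁ 0 ∧ g₁ 0 = m * g 0 ∧
      sinDeriv f =ᶠ[𝓝 0] fun A => A ^ m * g₁ A := by
  obtain ⟨p, hp⟩ := Real.analyticAt_sin (x := 0)
  have hs : AnalyticAt ℝ (dslope Real.sin 0) 0 := ⟨_, hp.has_fpower_series_dslope_fslope⟩
  refine ⟨fun A => dslope Real.sin 0 A * (m * g A + A * deriv g A), by fun_prop, by simp, ?_⟩
  filter_upwards [hf.deriv, hg.eventually_analyticAt] with A hfA hgA
  have hsin : Real.sin A = A * dslope Real.sin 0 A := by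
    simpa using (sub_smul_dslope Real.sin 0 A).symm
  have hpow : (m : ℝ) * A ^ (m - 1) * A = m * A ^ m := by
    cases m <;> simp [pow_succ, mul_assoc]
  rw [sinDeriv, hfA, deriv_fun_mul (by fun_prop) hgA.differentiableAt, deriv_pow_field, hsin]
  linear_combination dslope Real.sin 0 A * g A * hpow

-- The indicial equation at the singular point `0`: a solution `A ^ m * g A` with `g 0 ≠ 0` has
-- `m * (m - 1 + 2 * κ) = 0`.
lemma eq_zero_of_gegenbauerOp_eq_zero {κ μ : ℝ} (hκ : ∀ i : ℕ, 2 * κ ≠ -i) {f : ℝ → ℝ}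
    (hf : ContDiff ℝ ω f) (h0 : f 0 = 0) (hop : gegenbauerOp κ μ f = 0) : f = 0 := by
  have han : AnalyticOnNhd ℝ f Set.univ := hf.analyticOnNhd
  suffices hev : f =ᶠ[𝓝 0] 0 from funext fun A =>
    han.eqOn_zero_of_preconnected_of_eventuallyEq_zero isPreconnected_univ (Set.mem_univ 0) hev
      (Set.mem_univ A)
  by_contra hne
  obtain ⟨m, g, hg, hg0, hfg⟩ :=
    (han 0 (Set.mem_univ 0)).exists_eventuallyEq_pow_smul_nonzero_iff.2 hne
  simp only [sub_zero, smul_eq_mul] at hfg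
  obtain ⟨g₁, hg₁, hg₁0, hfg₁⟩ := exists_sinDeriv_eventuallyEq_pow_mul hg hfg
  obtain ⟨g₂, hg₂, hg₂0, hfg₂⟩ := exists_sinDeriv_eventuallyEq_pow_mul hg₁ hfg₁
  have hm : m ≠ 0 := by
    rintro rfl
    exact hg0 (by simpa [h0] using hfg.self_of_nhds.symm)
  let r : ℝ → ℝ := fun A => g₂ A + (2 * κ - 1) * Real.cos A * g₁ A + μ * Real.sin A ^ 2 * g A
  have hr : r =ᶠ[𝓝[≠] 0] fun _ => 0 := by
    filter_upwards [hfg.filter_mono nhdsWithin_le_nhds, hfg₁.filter_mono nhdsWithin_le_nhds,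
      hfg₂.filter_mono nhdsWithin_le_nhds, self_mem_nhdsWithin] with A h h₁ h₂ hA
    have hopA := congrFun hop A
    rw [gegenbauerOp, h, h₁, h₂, Pi.zero_apply] at hopA
    refine (mul_eq_zero.1 ?_).resolve_left (pow_ne_zero m hA)
    linear_combination hopA
  have hrcont : ContinuousAt r 0 := by
    have := hg.continuousAt; have := hg₁.continuousAt; have := hg₂.continuousAt
    fun_prop
  have hr0 : m * ((m - 1 + 2 * κ) * g 0) = 0 := by
    have := ((hrcont.eventuallyEq_nhds_iff_eventuallyEq_nhdsNE continuousAt_const).1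
      hr).self_of_nhds
    simp only [r, Real.sin_zero, Real.cos_zero, hg₂0, hg₁0] at this
    linear_combination this
  have hindicial : (m : ℝ) - 1 + 2 * κ = 0 := by simpa [hm, hg0] using hr0
  refine hκ (m - 1) ?_
  rw [Nat.cast_pred (Nat.pos_of_ne_zero hm)]
  linear_combination hindicial

lemma mul_eq_mul_of_gegenbauerOp_eq_zero {κ μ : ℝ} (hκ : ∀ i : ℕ, 2 * κ ≠ -i) {f g : ℝ → ℝ}
    (hf : ContDiff ℝ ω f) (hg : ContDiff ℝ ω g) (hopf : gegenbauerOp κ μ f = 0)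
    (hopg : gegenbauerOp κ μ g = 0) (A : ℝ) : g 0 * f A = f 0 * g A := by
  have hzero : (fun A => g 0 * f A - f 0 * g A) = 0 :=
    eq_zero_of_gegenbauerOp_eq_zero (μ := μ) hκ
      ((contDiff_const.mul hf).sub (contDiff_const.mul hg))
      (by ring)
      (funext fun A => by simp [gegenbauerOp_mul_sub_mul _ _ _ _ hf hg, hopf, hopg])
  exact sub_eq_zero.1 (congrFun hzero A)

end TrigonometricOperator

section ProductFormula

open Polynomial Finset
open scoped ContDiff

/-- The function `sin^i A * P⁽ⁱ⁾(cos (A - B))`: up to scalars, the `i`-th term of the addition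
formula expanding `P (cos A) P (cos B)`. -/
def addTerm (P : ℝ[X]) (B : ℝ) (i : ℕ) (A : ℝ) : ℝ :=
  Real.sin A ^ i * (derivative^[i] P).eval (Real.cos (A - B))

lemma contDiff_addTerm (P : ℝ[X]) (B : ℝ) (i : ℕ) : ContDiff ℝ ω (addTerm P B i) := by
  have haeval : ContDiff ℝ ω fun x : ℝ => aeval x (derivative^[i] P) := contDiff_aeval _ _
  have hP : ContDiff ℝ ω fun x => (derivative^[i] P).eval x := by
    simpa only [coe_aeval_eq_eval] using haeval
  have hcos : ContDiff ℝ ω fun A => Real.cos (A - B) := by fun_prop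
  exact (Real.contDiff_sin.pow i).mul (hP.comp hcos)

lemma sinDeriv_addTerm (P : ℝ[X]) (B : ℝ) (i : ℕ) :
    sinDeriv (addTerm P B i) = fun A =>
      i * Real.cos A * addTerm P B i A - Real.sin (A - B) * addTerm P B (i + 1) A := by
  funext A
  have hpow : (i : ℝ) * Real.sin A ^ (i - 1) * Real.sin A = i * Real.sin A ^ i := by
    cases i <;> simp [pow_succ, mul_assoc]
  have hcos : HasDerivAt (fun A => Real.cos (A - B)) (-Real.sin (A - B)) A :=
    (Real.hasDerivAt_cos _).comp_sub_const A B
  have h : HasDerivAt (addTerm P B i) _ A :=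
    ((Real.hasDerivAt_sin A).pow i).mul (((derivative^[i] P).hasDerivAt _).comp A hcos)
  rw [sinDeriv, h.deriv, addTerm, addTerm, Function.iterate_succ_apply', Pi.pow_apply]
  linear_combination Real.cos A * (derivative^[i] P).eval (Real.cos (A - B)) * hpow

lemma sinDeriv_sinDeriv_addTerm (P : ℝ[X]) (B : ℝ) (i : ℕ) (A : ℝ) :
    sinDeriv (sinDeriv (addTerm P B i)) A =
      i * (Real.cos A * sinDeriv (addTerm P B i) A - Real.sin A ^ 2 * addTerm P B i A) -
        (Real.sin (A - B) * sinDeriv (addTerm P B (i + 1)) A +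
          Real.sin A * Real.cos (A - B) * addTerm P B (i + 1) A) := by
  have hT i : HasDerivAt (addTerm P B i) (deriv (addTerm P B i) A) A :=
    ((contDiff_addTerm P B i).differentiable (by simp) A).hasDerivAt
  have hsin : HasDerivAt (fun A => Real.sin (A - B)) (Real.cos (A - B)) A :=
    (Real.hasDerivAt_sin _).comp_sub_const A B
  have h : HasDerivAt (fun A => i * Real.cos A * addTerm P B i A -
      Real.sin (A - B) * addTerm P B (i + 1) A) _ A :=
    (((Real.hasDerivAt_cos A).const_mul (i : ℝ)).mul (hT i)).sub (hsin.mul (hT (i + 1)))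
  conv_lhs => rw [sinDeriv, sinDeriv_addTerm, h.deriv]
  simp only [sinDeriv]
  ring

lemma gegenbauerOp_addTerm {κ μ : ℝ} {P : ℝ[X]} (hP : IsGegenbauerSol κ μ P) (B : ℝ) (i : ℕ)
    (A : ℝ) :
    gegenbauerOp κ μ (addTerm P B i) A =
      i * (i - 1 + 2 * κ) * addTerm P B i A +
        2 * (κ + i) * Real.sin B * addTerm P B (i + 1) A := by
  have hode := congrArg (eval (Real.cos (A - B))) (hP.iterate i)
  simp only [eval_add, eval_sub, eval_mul, eval_pow, eval_X, eval_C, eval_one, eval_zero,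
    ← Function.iterate_succ_apply' (derivative (R := ℝ)), ← Real.sin_sq] at hode
  have hsinB : Real.sin B = Real.sin A * Real.cos (A - B) - Real.cos A * Real.sin (A - B) := by
    rw [← Real.sin_sub, sub_sub_cancel]
  rw [gegenbauerOp, sinDeriv_sinDeriv_addTerm, sinDeriv_addTerm, sinDeriv_addTerm]
  simp only [addTerm, hsinB, Nat.cast_add, Nat.cast_one]
  linear_combination Real.sin A ^ (i + 2) * hode +
    i * (i - 1 + 2 * κ) * Real.sin A ^ i * (derivative^[i] P).eval (Real.cos (A - B)) *
      Real.sin_sq_add_cos_sq A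

lemma gegenbauerOp_sum_addTerm {κ μ : ℝ} (hκ : ∀ i : ℕ, 2 * κ ≠ -i) {P : ℝ[X]}
    (hP : IsGegenbauerSol κ μ P) (B : ℝ) {J : ℕ} (hJ : derivative^[J] P = 0) (A : ℝ) :
    gegenbauerOp κ μ (fun A => ∑ i ∈ range J,
      poch κ i * (-2 * Real.sin B) ^ i / (poch (2 * κ) i * i.factorial) * addTerm P B i A) A =
        0 := by
  rw [gegenbauerOp_sum_mul _ _ _ _ (contDiff_addTerm P B)]
  set a : ℕ → ℝ := fun i =>
    poch κ i * (-2 * Real.sin B) ^ i / (poch (2 * κ) i * i.factorial) with ha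
  have hrec (i : ℕ) : a (i + 1) * ((i + 1) * (i + 2 * κ)) =
      -(a i * (2 * (κ + i) * Real.sin B)) := by
    have hne : 2 * κ + i ≠ 0 := by simpa [add_eq_zero_iff_eq_neg] using hκ i
    simp only [ha, poch_succ, Nat.factorial_succ, pow_succ, Nat.cast_mul, Nat.cast_succ]
    field_simp [poch_ne_zero hκ i, show κ * 2 + i ≠ 0 by rwa [mul_comm]]
    ring
  let u : ℕ → ℝ := fun i => a i * (i * (i - 1 + 2 * κ)) * addTerm P B i A
  have htelescope (i : ℕ) : a i * gegenbauerOp κ μ (addTerm P B i) A = u i - u (i + 1) := by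
    simp only [u, gegenbauerOp_addTerm hP, Nat.cast_succ]
    linear_combination addTerm P B (i + 1) A * hrec i
  rw [sum_congr rfl fun i _ => htelescope i, sum_range_sub']
  simp [u, addTerm, hJ]

lemma eval_one_mul_sum_addTerm {κ μ : ℝ} (hκ : ∀ i : ℕ, 2 * κ ≠ -i) {P : ℝ[X]}
    (hP : IsGegenbauerSol κ μ P) {J : ℕ} (hJ : derivative^[J + 1] P = 0) (A B : ℝ) :
    P.eval 1 * ∑ i ∈ range (J + 1),
      poch κ i * (-2 * Real.sin B) ^ i / (poch (2 * κ) i * i.factorial) * addTerm P B i A =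
        P.eval (Real.cos A) * P.eval (Real.cos B) := by
  have hsum : ContDiff ℝ ω fun A => ∑ i ∈ range (J + 1),
      poch κ i * (-2 * Real.sin B) ^ i / (poch (2 * κ) i * i.factorial) * addTerm P B i A :=
    ContDiff.sum fun i _ => contDiff_const.mul (contDiff_addTerm P B i)
  have h := mul_eq_mul_of_gegenbauerOp_eq_zero hκ hsum (contDiff_addTerm P 0 0)
    (funext (gegenbauerOp_sum_addTerm hκ hP B hJ))
    (funext fun A => by simp [gegenbauerOp_addTerm hP]) A
  simpa [addTerm, sum_range_succ', mul_comm] using h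

theorem gegenbauer_mul_gegenbauer {κ : ℝ} (hκ : ∀ i : ℕ, 2 * κ ≠ -i) (j : ℕ) (A B : ℝ) :
    (gegenbauer κ j).eval (Real.cos A) * (gegenbauer κ j).eval (Real.cos B) /
        (gegenbauer κ j).eval 1 =
      ∑ i ∈ range (j + 1), poch κ i * poch κ i / (poch (2 * κ) i * i.factorial) *
        (-4 * Real.sin A * Real.sin B) ^ i *
          (gegenbauer (κ + i) (j - i)).eval (Real.cos (A - B)) := by
  rw [← eval_one_mul_sum_addTerm hκ (isGegenbauerSol_gegenbauer κ j)
    (iterate_derivative_gegenbauer_eq_zero κ j.lt_succ_self),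
    mul_div_cancel_left₀ _ (gegenbauer_eval_one_ne_zero hκ j)]
  refine sum_congr rfl fun i hi => ?_
  obtain ⟨d, rfl⟩ := Nat.exists_eq_add_of_le (Nat.lt_succ_iff.1 (mem_range.1 hi))
  rw [addTerm, iterate_derivative_gegenbauer, Nat.add_sub_cancel_left, eval_mul, eval_C,
    show -4 * Real.sin A * Real.sin B = 2 * ((-2 * Real.sin B) * Real.sin A) by ring, mul_pow,
    mul_pow]
  ring

end ProductFormula

section Trigonometry

open Complex Finset

lemma prod_one_sub_pow_mul {R : Type*} [CommRing R] [IsDomain R] {n : ℕ} {ζ : R}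
    (hζ : IsPrimitiveRoot ζ n) (hn : 0 < n) (y : R) :
    ∏ s : Fin n, (1 - ζ ^ (s + 1 : ℕ) * y) = 1 - y ^ n := by
  classical
  have hinj : Function.Injective fun s : Fin n => ζ ^ (s + 1 : ℕ) := fun s t hst =>
    Fin.ext <| hζ.pow_inj s.2 t.2 <| mul_right_cancel₀ (hζ.ne_zero hn.ne') <| by
      simpa only [pow_succ] using hst
  have himage : univ.image (fun s : Fin n => ζ ^ (s + 1 : ℕ)) =
      Polynomial.nthRootsFinset n (1 : R) := by
    refine eq_of_subset_of_card_le (image_subset_iff.2 fun s _ => ?_) ?_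
    · rw [Polynomial.mem_nthRootsFinset hn, pow_right_comm, hζ.pow_eq_one, one_pow]
    · rw [hζ.card_nthRootsFinset, card_image_of_injective _ hinj, card_univ, Fintype.card_fin]
  have h := hζ.pow_sub_pow_eq_prod_sub_mul 1 y hn
  rw [one_pow] at h
  rw [h, ← himage, prod_image hinj.injOn]

lemma normSq_one_sub_exp_mul (β w : ℝ) :
    normSq (1 - exp (β * I) * w) = 1 - 2 * Real.cos β * w + w ^ 2 := by
  rw [normSq_apply]
  simp only [sub_re, sub_im, one_re, one_im, re_mul_ofReal, im_mul_ofReal, exp_ofReal_mul_I_re,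
    exp_ofReal_mul_I_im]
  linear_combination w ^ 2 * Real.sin_sq_add_cos_sq β

lemma exp_add_two_pi_mul_div (α : ℝ) (n s : ℕ) :
    exp ((α + 2 * Real.pi * s / n : ℝ) * I) = exp (2 * Real.pi * I / n) ^ s * exp (α * I) := by
  rw [← exp_nat_mul, ← exp_add]
  congr 1
  push_cast
  ring

lemma prod_one_sub_two_mul_b {n : ℕ} (hn : n ≠ 0) (α z : ℝ) :
    ∏ s : Fin n, (1 - 2 * b α n (s + 1) * z + z ^ 2) =
      1 - 2 * Real.cos (n * α) * z ^ n + (z ^ n) ^ 2 := by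
  simp only [b, ← normSq_one_sub_exp_mul, ← map_prod, exp_add_two_pi_mul_div]
  simp only [mul_assoc (_ ^ _) (exp _)]
  rw [prod_one_sub_pow_mul (isPrimitiveRoot_exp n hn) (Nat.pos_of_ne_zero hn), mul_pow,
    ← exp_nat_mul, ofReal_pow, ofReal_mul, ofReal_natCast, mul_assoc]

lemma prod_one_sub_C_two_mul_b {n : ℕ} (hn : n ≠ 0) (α : ℝ) (z : PowerSeries ℝ) :
    ∏ s : Fin n, (1 - PowerSeries.C (2 * b α n (s + 1)) * z + z ^ 2) =
      1 - PowerSeries.C (2 * Real.cos (n * α)) * z ^ n + (z ^ n) ^ 2 := by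
  have h : ∏ s : Fin n, (1 - Polynomial.C (2 * b α n (s + 1)) * Polynomial.X + Polynomial.X ^ 2) =
      1 - Polynomial.C (2 * Real.cos (n * α)) * Polynomial.X ^ n + (Polynomial.X ^ n) ^ 2 :=
    Polynomial.funext fun x => by simpa [Polynomial.eval_prod] using prod_one_sub_two_mul_b hn α x
  simpa [map_prod] using congrArg (Polynomial.aeval z) h

end Trigonometry

section CatalanSeries

open PowerSeries

/-- The coefficients of the `a`-th power of the Catalan series, namely
`a Γ(a + 2m) / (m! Γ(a + m + 1))`, written so that they are visibly polynomial in `a`. -/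
def catalanPowCoeff (a : ℝ) : ℕ → ℝ
  | 0 => 1
  | m + 1 => a * poch (a + m + 2) m / (m + 1).factorial

lemma div_factorial_mul_Gamma (a : ℝ) (m : ℕ) :
    a / (m.factorial * Real.Gamma (a + m + 1)) = catalanPowCoeff a m / Real.Gamma (a + 2 * m) := by
  rcases m with _ | m
  · have h := inv_Gamma_eq_poch_div a 1
    simpa [catalanPowCoeff, poch_succ] using h.symm
  · have h := inv_Gamma_eq_poch_div (a + m + 2) m
    rw [show a + m + 2 + m = a + 2 * (m + 1 : ℕ) by push_cast; ring] at h
    rw [show a + (m + 1 : ℕ) + 1 = a + m + 2 by push_cast; ring, div_eq_mul_inv, mul_inv, h,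
      catalanPowCoeff]
    ring

lemma catalanPowCoeff_add_one_succ (a : ℝ) (m : ℕ) :
    catalanPowCoeff (a + 1) (m + 1) = catalanPowCoeff a (m + 1) + catalanPowCoeff (a + 2) m := by
  rcases m with _ | m
  · simp [catalanPowCoeff]
  · simp only [catalanPowCoeff]
    rw [poch_succ, poch_succ_left, Nat.factorial_succ (m + 1)]
    push_cast
    rw [show a + 1 + ((m : ℝ) + 1) + 2 = a + m + 4 by ring,
      show a + ((m : ℝ) + 1) + 2 + 1 = a + m + 4 by ring,
      show a + 2 + (m : ℝ) + 2 = a + m + 4 by ring]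
    field_simp
    ring

lemma exists_eq_one_add_X_sq_mul_sq : ∃ c : ℝ⟦X⟧, c = 1 + X ^ 2 * c ^ 2 := by
  have h := congrArg (fun f => expand 2 two_ne_zero (map (Nat.castRingHom ℝ) f))
    catalanSeries_sq_mul_X_add_one
  simp only [map_add, map_mul, map_pow, map_one, map_X, expand_X] at h
  exact ⟨_, h.symm.trans (by ring)⟩

variable {c : ℝ⟦X⟧}

lemma coeff_catalan_pow (hc : c = 1 + X ^ 2 * c ^ 2) (m a : ℕ) :
    coeff (2 * m) (c ^ a) = catalanPowCoeff a m ∧ coeff (2 * m + 1) (c ^ a) = 0 := by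
  have hrec (a : ℕ) : c ^ (a + 1) = c ^ a + X ^ 2 * c ^ (a + 2) := by linear_combination c ^ a * hc
  induction m generalizing a with
  | zero =>
    induction a with
    | zero => simp [catalanPowCoeff, coeff_one]
    | succ a ih =>
      rw [hrec, map_add, map_add, ih.1, ih.2, coeff_X_pow_mul', coeff_X_pow_mul']
      simp [catalanPowCoeff]
  | succ m ihm =>
    induction a with
    | zero => simp [catalanPowCoeff, coeff_one]
    | succ a ih =>
      rw [hrec, map_add, map_add, ih.1, ih.2, show 2 * (m + 1) = 2 * m + 2 by ring,
        show 2 * m + 2 + 1 = 2 * m + 1 + 2 by ring, coeff_X_pow_mul, coeff_X_pow_mul, (ihm _).1,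
        (ihm _).2, Nat.cast_add, Nat.cast_ofNat, Nat.cast_succ]
      exact ⟨(catalanPowCoeff_add_one_succ a m).symm, add_zero 0⟩

end CatalanSeries

section Expansion

open PowerSeries Finset

section NatParameter

variable {n : ℕ} {c : ℝ⟦X⟧}

lemma prod_one_sub_C_two_mul_b_mul_pow (hn : n ≠ 0) (α : ℝ) (hc : c = 1 + X ^ 2 * c ^ 2) :
    (∏ s : Fin n, (1 - C (2 * b α n (s + 1)) * X)) * c ^ n =
      1 - C (2 * Real.cos (n * α)) * (X * c) ^ n + ((X * c) ^ n) ^ 2 := by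
  rw [← prod_one_sub_C_two_mul_b hn, ← Fin.prod_const, ← prod_mul_distrib]
  exact prod_congr rfl fun s _ => by linear_combination hc

lemma prod_binomSeries_natCast (hn : n ≠ 0) (α : ℝ) (hc : c = 1 + X ^ 2 * c ^ 2) (κ : ℕ) :
    ∏ s : Fin n, binomSeries κ (2 * b α n (s + 1)) =
      c ^ (n * κ) * (gegenbauerSeries κ (Real.cos (n * α))).subst ((X * c) ^ n) := by
  have hs : HasSubst ((X * c) ^ n) := .of_constantCoeff_zero' (by simp [hn])
  set Q : ℝ⟦X⟧ := ∏ s : Fin n, (1 - C (2 * b α n (s + 1)) * X) with hQ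
  have hleft : (∏ s : Fin n, binomSeries κ (2 * b α n (s + 1))) * Q ^ κ = 1 := by
    rw [mul_comm, hQ, ← prod_pow, ← prod_mul_distrib]
    exact prod_eq_one fun s _ => one_sub_pow_mul_binomSeries κ _
  have hright := congrArg (substAlgHom hs) (pow_mul_gegenbauerSeries κ (Real.cos (n * α)))
  have hC : substAlgHom hs (C (2 * Real.cos (n * α))) = C (2 * Real.cos (n * α)) :=
    (substAlgHom hs).commutes (2 * Real.cos (n * α))
  rw [map_mul, map_pow, map_add, map_sub, map_mul, map_pow, map_one, substAlgHom_X, hC,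
    coe_substAlgHom, ← prod_one_sub_C_two_mul_b_mul_pow hn α hc, mul_pow, mul_assoc,
    ← pow_mul] at hright
  exact left_inv_eq_right_inv hleft hright

lemma coeff_X_pow_mul_catalan_pow (hc : c = 1 + X ^ 2 * c ^ 2) (i a N : ℕ) :
    coeff N (X ^ i * c ^ a) =
      ∑ m ∈ range (N + 1), if 2 * m + i = N then catalanPowCoeff a m else 0 := by
  rw [coeff_X_pow_mul']
  split_ifs with hi
  · obtain ⟨d, rfl⟩ := Nat.exists_eq_add_of_le hi
    rw [Nat.add_sub_cancel_left]
    rcases Nat.even_or_odd' d with ⟨m, rfl | rfl⟩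
    · rw [(coeff_catalan_pow hc m a).1, sum_eq_single_of_mem m (by simp; omega)
        fun m' _ hm' => if_neg (by omega), if_pos (add_comm _ _)]
    · rw [(coeff_catalan_pow hc m a).2]
      exact (sum_eq_zero fun m' _ => if_neg (by omega)).symm
  · exact (sum_eq_zero fun m' _ => if_neg (by omega)).symm

lemma coeff_catalan_pow_mul_subst (hn : n ≠ 0) (hc : c = 1 + X ^ 2 * c ^ 2) (κ : ℕ) (H : ℝ⟦X⟧)
    (N : ℕ) : coeff N (c ^ (n * κ) * H.subst ((X * c) ^ n)) =
      ∑ p ∈ indexPairs N n, catalanPowCoeff (n * (p.1 + κ)) p.2 * coeff p.1 H := by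
  rw [coeff_mul_subst (dvd_pow (dvd_mul_right X c) hn), indexPairs, sum_filter, sum_product]
  refine sum_congr rfl fun l _ => ?_
  rw [show c ^ (n * κ) * ((X * c) ^ n) ^ l = X ^ (n * l) * c ^ (n * (l + κ)) by ring,
    coeff_X_pow_mul_catalan_pow hc, mul_sum]
  refine sum_congr rfl fun m _ => ?_
  rw [mul_ite, mul_zero, mul_comm (coeff l H), Nat.cast_mul, Nat.cast_add]

end NatParameter

lemma coeff_prod_eq_sum_piAntidiag {R ι : Type*} [CommSemiring R] [DecidableEq ι] (s : Finset ι)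
    (f : ι → R⟦X⟧) (N : ℕ) :
    coeff N (∏ i ∈ s, f i) = ∑ m ∈ piAntidiag s N, ∏ i ∈ s, coeff (m i) (f i) := by
  rw [coeff_prod, finsuppAntidiag, sum_map]
  exact sum_attach (piAntidiag s N) fun m => ∏ i ∈ s, coeff (m i) (f i)

/-- Functions given by evaluating a polynomial; those in the parameter `κ` are determined by their
values at the natural numbers. -/
def IsPolynomialFun {R : Type*} [CommRing R] (f : R → R) : Prop :=
  ∃ p : Polynomial R, ∀ x, f x = p.eval x

section IsPolynomialFun

variable {R : Type*} [CommRing R] {f g : R → R}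

lemma isPolynomialFun_const (a : R) : IsPolynomialFun fun _ => a := ⟨.C a, by simp⟩

lemma isPolynomialFun_id : IsPolynomialFun fun x : R => x := ⟨.X, by simp⟩

lemma IsPolynomialFun.add (hf : IsPolynomialFun f) (hg : IsPolynomialFun g) :
    IsPolynomialFun fun x => f x + g x := by
  obtain ⟨p, hp⟩ := hf
  obtain ⟨q, hq⟩ := hg
  exact ⟨p + q, fun x => by simp [hp, hq]⟩

lemma IsPolynomialFun.mul (hf : IsPolynomialFun f) (hg : IsPolynomialFun g) :
    IsPolynomialFun fun x => f x * g x := by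
  obtain ⟨p, hp⟩ := hf
  obtain ⟨q, hq⟩ := hg
  exact ⟨p * q, fun x => by simp [hp, hq]⟩

lemma IsPolynomialFun.comp (hf : IsPolynomialFun f) (hg : IsPolynomialFun g) :
    IsPolynomialFun fun x => f (g x) := by
  obtain ⟨p, hp⟩ := hf
  obtain ⟨q, hq⟩ := hg
  exact ⟨p.comp q, fun x => by simp [hp, hq]⟩

lemma IsPolynomialFun.sum {ι : Type*} (s : Finset ι) {f : ι → R → R}
    (hf : ∀ i, IsPolynomialFun (f i)) : IsPolynomialFun fun x => ∑ i ∈ s, f i x := by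
  choose p hp using hf
  exact ⟨∑ i ∈ s, p i, fun x => by simp [hp, Polynomial.eval_finsetSum]⟩

lemma IsPolynomialFun.prod {ι : Type*} (s : Finset ι) {f : ι → R → R}
    (hf : ∀ i, IsPolynomialFun (f i)) : IsPolynomialFun fun x => ∏ i ∈ s, f i x := by
  choose p hp using hf
  exact ⟨∏ i ∈ s, p i, fun x => by simp [hp, Polynomial.eval_prod]⟩

lemma IsPolynomialFun.eq_of_natCast [IsDomain R] [CharZero R] (hf : IsPolynomialFun f)
    (hg : IsPolynomialFun g) (h : ∀ κ : ℕ, f κ = g κ) (x : R) : f x = g x := by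
  obtain ⟨p, hp⟩ := hf
  obtain ⟨q, hq⟩ := hg
  have hinf : {x | p.eval x = q.eval x}.Infinite :=
    (Set.infinite_range_of_injective (Nat.cast_injective (R := R))).mono <|
      Set.range_subset_iff.2 fun κ => by simpa [hp, hq] using h κ
  rw [hp, hq, Polynomial.eq_of_infinite_eval_eq p q hinf]

end IsPolynomialFun

lemma isPolynomialFun_poch (j : ℕ) : IsPolynomialFun fun x => poch x j :=
  ⟨ascPochhammer ℝ j, fun _ => rfl⟩

lemma isPolynomialFun_catalanPowCoeff (m : ℕ) : IsPolynomialFun fun a => catalanPowCoeff a m := by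
  rcases m with _ | m
  · exact isPolynomialFun_const 1
  · simp only [catalanPowCoeff, div_eq_mul_inv]
    exact (isPolynomialFun_id.mul ((isPolynomialFun_poch m).comp
      ((isPolynomialFun_id.add (isPolynomialFun_const _)).add (isPolynomialFun_const _)))).mul
      (isPolynomialFun_const _)

lemma isPolynomialFun_eval_gegenbauer (j : ℕ) (x : ℝ) :
    IsPolynomialFun fun κ => (gegenbauer κ j).eval x := by
  simp only [gegenbauer, Polynomial.eval_finsetSum, Polynomial.eval_mul, Polynomial.eval_C,
    div_eq_mul_inv]
  exact .sum _ fun l => (((isPolynomialFun_const _).mul (isPolynomialFun_poch _)).mul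
    (isPolynomialFun_const _)).mul (isPolynomialFun_const _)

theorem sum_piAntidiag_prod_eq_sum_indexPairs {n : ℕ} (hn : n ≠ 0) (α κ : ℝ) (N : ℕ) :
    ∑ m ∈ piAntidiag (univ : Finset (Fin n)) N,
        ∏ s, poch κ (m s) / (m s).factorial * (2 * b α n (s + 1)) ^ m s =
      ∑ p ∈ indexPairs N n, catalanPowCoeff (n * (p.1 + κ)) p.2 *
        (gegenbauer κ p.1).eval (Real.cos (n * α)) := by
  revert κ
  refine IsPolynomialFun.eq_of_natCast ?_ ?_ fun κ => ?_
  · simp only [div_eq_mul_inv]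
    exact .sum _ fun m => .prod _ fun s =>
      ((isPolynomialFun_poch _).mul (isPolynomialFun_const _)).mul (isPolynomialFun_const _)
  · exact .sum _ fun p => ((isPolynomialFun_catalanPowCoeff p.2).comp
      ((isPolynomialFun_const _).mul ((isPolynomialFun_const _).add isPolynomialFun_id))).mul
      (isPolynomialFun_eval_gegenbauer p.1 _)
  · obtain ⟨c, hc⟩ := exists_eq_one_add_X_sq_mul_sq
    have h := congrArg (coeff N) (prod_binomSeries_natCast hn α hc κ)
    rw [coeff_catalan_pow_mul_subst hn hc, coeff_prod_eq_sum_piAntidiag] at h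
    simpa only [coeff_binomSeries, coeff_gegenbauerSeries] using h

end Expansion

section Reindexing

open Finset

variable {M : Type*} [AddCommMonoid M]

lemma sum_piAntidiag_sum_range_iInf {ι : Type*} [Fintype ι] [DecidableEq ι] [Nonempty ι] (N : ℕ)
    (f : ℕ → (ι → ℕ) → M) :
    ∑ m ∈ piAntidiag (univ : Finset ι) N, ∑ j ∈ range ((⨅ s, m s) + 1), f j (fun s => m s - j) =
      ∑ j ∈ range (N / Fintype.card ι + 1),
        ∑ m ∈ piAntidiag (univ : Finset ι) (N - Fintype.card ι * j), f j m := by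
  have hinf (m : ι → ℕ) (j : ℕ) : j ≤ ⨅ s, m s ↔ ∀ s, j ≤ m s :=
    le_ciInf_iff (OrderBot.bddBelow _)
  have hdiv (j : ℕ) : j ≤ N / Fintype.card ι ↔ Fintype.card ι * j ≤ N := by
    rw [Nat.le_div_iff_mul_le Fintype.card_pos, mul_comm]
  have hsum (m : ι → ℕ) (j : ℕ) : ∑ s, (m s + j) = ∑ s, m s + Fintype.card ι * j := by
    rw [sum_add_distrib, sum_const, card_univ, smul_eq_mul]
  have hcancel {m : ι → ℕ} {j : ℕ} (h : ∀ s, j ≤ m s) : (fun s => m s - j + j) = m :=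
    funext fun s => Nat.sub_add_cancel (h s)
  rw [sum_sigma', sum_sigma']
  refine sum_nbij' (fun x => ⟨x.2, fun s => x.1 s - x.2⟩) (fun x => ⟨fun s => x.2 s + x.1, x.1⟩)
    ?_ ?_ ?_ ?_ fun _ _ => rfl
  all_goals
    rintro ⟨x, y⟩ h
    simp only [mem_sigma, mem_piAntidiag, mem_univ, implies_true, and_true, mem_range,
      Nat.lt_succ_iff, hinf, hdiv] at h ⊢
  · have hm := hsum (fun s => x s - y) y
    rw [hcancel h.2] at hm
    omega
  · exact ⟨by rw [hsum, h.2, Nat.sub_add_cancel h.1], fun s => Nat.le_add_left _ _⟩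
  · rw [hcancel h.2]
  · simp

lemma mem_indexPairs {N n : ℕ} (hn : n ≠ 0) {p : ℕ × ℕ} :
    p ∈ indexPairs N n ↔ 2 * p.2 + n * p.1 = N := by
  have := Nat.le_mul_of_pos_left p.1 (Nat.pos_of_ne_zero hn)
  simp only [indexPairs, mem_filter, mem_product, mem_range]
  omega

lemma sum_range_sum_indexPairs {n : ℕ} (hn : n ≠ 0) (N : ℕ) (f : ℕ → ℕ → ℕ → M) :
    ∑ j ∈ range (N / n + 1), ∑ p ∈ indexPairs (N - n * j) n, f j p.1 p.2 =
      ∑ p ∈ indexPairs N n, ∑ j ∈ range (p.1 + 1), f j (p.1 - j) p.2 := by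
  have hdiv (j : ℕ) : j ≤ N / n ↔ n * j ≤ N := by
    rw [Nat.le_div_iff_mul_le (Nat.pos_of_ne_zero hn), mul_comm]
  rw [sum_sigma', sum_sigma']
  refine sum_nbij' (fun x => ⟨(x.2.1 + x.1, x.2.2), x.1⟩) (fun x => ⟨x.2, (x.1.1 - x.2, x.1.2)⟩)
    ?_ ?_ ?_ ?_ ?_
  · rintro ⟨j, l, m⟩ h
    simp only [mem_sigma, mem_indexPairs hn, mem_range, Nat.lt_succ_iff, hdiv, mul_add] at h ⊢
    omega
  · rintro ⟨⟨l, m⟩, j⟩ h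
    simp only [mem_sigma, mem_indexPairs hn, mem_range, Nat.lt_succ_iff, hdiv, Nat.mul_sub] at h ⊢
    have := Nat.mul_le_mul_left n h.2
    omega
  · rintro ⟨j, l, m⟩ _
    simp
  · rintro ⟨⟨l, m⟩, j⟩ h
    rw [mem_sigma, mem_range, Nat.lt_succ_iff] at h
    simp [Nat.sub_add_cancel h.2]
  · rintro ⟨j, l, m⟩ _
    simp

end Reindexing

section Identity

open Finset

variable {n : ℕ}

lemma S_eq_sum_catalanPowCoeff (hn : n ≠ 0) (k φ θ : ℝ) (N : ℕ) :
    S N n k φ θ = (∑ p ∈ indexPairs N n, catalanPowCoeff (n * (p.1 + k)) p.2 *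
      ((gegenbauer k p.1).eval (Real.cos (n * φ)) * (gegenbauer k p.1).eval (Real.cos (n * θ)) /
        (gegenbauer k p.1).eval 1)) / Real.Gamma (n * k + N) := by
  rw [S, sum_div]
  refine sum_congr rfl fun p hp => ?_
  rw [div_factorial_mul_Gamma, ← (mem_indexPairs hn).1 hp]
  push_cast
  ring_nf

lemma two_pow_mul_sum_piAntidiag_prod (hn : n ≠ 0) (α κ : ℝ) (N : ℕ) :
    2 ^ N * ∑ m ∈ piAntidiag (univ : Finset (Fin n)) N,
        ∏ s, poch κ (m s) / (m s).factorial * b α n (s + 1) ^ m s =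
      ∑ p ∈ indexPairs N n, catalanPowCoeff (n * (p.1 + κ)) p.2 *
        (gegenbauer κ p.1).eval (Real.cos (n * α)) := by
  rw [← sum_piAntidiag_prod_eq_sum_indexPairs hn, mul_sum]
  refine sum_congr rfl fun m hm => ?_
  rw [← (mem_piAntidiag.1 hm).1, ← prod_pow_eq_pow_sum, ← prod_mul_distrib]
  exact prod_congr rfl fun s _ => by ring

lemma two_pow_mul_sum_piAntidiag_sum_range_iInf (hn : n ≠ 0) (α κ : ℝ) (u : ℕ → ℝ) (N : ℕ) :
    2 ^ N * ∑ m ∈ piAntidiag (univ : Finset (Fin n)) N, ∑ j ∈ range ((⨅ s, m s) + 1), u j *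
        ∏ s, poch (κ + j) (m s - j) / (m s - j).factorial * b α n (s + 1) ^ (m s - j) =
      ∑ p ∈ indexPairs N n, catalanPowCoeff (n * (p.1 + κ)) p.2 * ∑ j ∈ range (p.1 + 1),
        (2 ^ n) ^ j * u j * (gegenbauer (κ + j) (p.1 - j)).eval (Real.cos (n * α)) := by
  have : NeZero n := ⟨hn⟩
  rw [sum_piAntidiag_sum_range_iInf N fun j m =>
    u j * ∏ s : Fin n, poch (κ + j) (m s) / (m s).factorial * b α n (s + 1) ^ m s,
    Fintype.card_fin, mul_sum]
  have hinner : ∀ j ∈ range (N / n + 1),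
      2 ^ N * ∑ m ∈ piAntidiag (univ : Finset (Fin n)) (N - n * j),
        u j * ∏ s, poch (κ + j) (m s) / (m s).factorial * b α n (s + 1) ^ m s =
      ∑ p ∈ indexPairs (N - n * j) n, (2 ^ n) ^ j * u j *
        (catalanPowCoeff (n * (p.1 + (κ + j))) p.2 *
          (gegenbauer (κ + j) p.1).eval (Real.cos (n * α))) := fun j hj => by
    have hj' : j * n ≤ N :=
      (Nat.le_div_iff_mul_le (Nat.pos_of_ne_zero hn)).1 (mem_range_succ_iff.1 hj)
    rw [← mul_sum, ← mul_sum, ← two_pow_mul_sum_piAntidiag_prod hn,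
      show (2 : ℝ) ^ N = 2 ^ (N - n * j) * (2 ^ n) ^ j by
        rw [← pow_mul, ← pow_add, Nat.sub_add_cancel (mul_comm n j ▸ hj')]]
    ring
  rw [sum_congr rfl hinner, sum_range_sum_indexPairs hn N fun j l m =>
    (2 ^ n) ^ j * u j * (catalanPowCoeff (n * (l + (κ + j))) m *
      (gegenbauer (κ + j) l).eval (Real.cos (n * α)))]
  refine sum_congr rfl fun p _ => ?_
  rw [mul_sum]
  refine sum_congr rfl fun j hj => ?_
  rw [Nat.cast_sub (mem_range_succ_iff.1 hj), ← add_sub_right_comm, ← add_assoc,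
    add_sub_cancel_right]
  ring

lemma two_pow_mul_neg_two_zpow (n : ℕ) (x y : ℝ) :
    2 ^ n * (-(2 : ℝ) ^ (2 - (n : ℤ)) * x * y) = -4 * x * y := by
  rw [zpow_sub₀ two_ne_zero, zpow_natCast]
  field_simp
  ring

end Identity

end DihedralGegenbauer

end

open DihedralGegenbauer Finset in
theorem theorem1_general (n : ℕ) (hn : 1 ≤ n) (k : ℝ) (hk : ∀ i : ℕ, 2 * k ≠ -i) (φ θ : ℝ)
    (N : ℕ) :
    S N n k φ θ = 2 ^ N / Real.Gamma (n * k + N) *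
      ∑ m ∈ piAntidiag (univ : Finset (Fin n)) N, ∑ j ∈ range ((⨅ s, m s) + 1),
        poch k j * poch k j / (poch (2 * k) j * j.factorial) *
          (-(2 : ℝ) ^ (2 - (n : ℤ)) * Real.sin (n * θ) * Real.sin (n * φ)) ^ j *
          ∏ s : Fin n, poch (k + j) (m s - j) / (m s - j).factorial *
            b (θ - φ) n (s + 1) ^ (m s - j) ∧
    S N n k 0 θ = 2 ^ N / Real.Gamma (n * k + N) *
      ∑ m ∈ piAntidiag (univ : Finset (Fin n)) N,
        ∏ s : Fin n, poch k (m s) * (b θ n (s + 1) ^ m s / (m s).factorial) := by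
  have hn₀ : n ≠ 0 := Nat.one_le_iff_ne_zero.1 hn
  refine ⟨?_, ?_⟩
  · rw [S_eq_sum_catalanPowCoeff hn₀, div_mul_eq_mul_div,
      two_pow_mul_sum_piAntidiag_sum_range_iInf hn₀ (θ - φ) k fun j =>
        poch k j * poch k j / (poch (2 * k) j * j.factorial) *
          (-(2 : ℝ) ^ (2 - (n : ℤ)) * Real.sin (n * θ) * Real.sin (n * φ)) ^ j]
    congr 1
    refine sum_congr rfl fun p _ => ?_
    rw [mul_comm (Polynomial.eval _ _) (Polynomial.eval _ _), gegenbauer_mul_gegenbauer hk,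
      ← mul_sub]
    simp only [← two_pow_mul_neg_two_zpow n, mul_pow, mul_assoc, mul_left_comm]
  · have h := two_pow_mul_sum_piAntidiag_prod hn₀ θ k N
    simp only [div_mul_eq_mul_div, mul_div_assoc] at h
    rw [S_eq_sum_catalanPowCoeff hn₀, div_mul_eq_mul_div, h]
    congr 1
    refine sum_congr rfl fun p _ => ?_
    rw [mul_zero, Real.cos_zero, mul_div_cancel_left₀ _ (gegenbauer_eval_one_ne_zero hk p.1)]

theorem theorem1 (n : ℕ) (hn : 1 ≤ n) (k : ℝ) (hk : 0 < k) (φ θ : ℝ) (N : ℕ) :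
    DihedralGegenbauer.S N n k φ θ =
        2 ^ N / Real.Gamma ((n : ℝ) * k + (N : ℝ)) *
          ∑ m ∈ Finset.piAntidiag (Finset.univ : Finset (Fin n)) N,
            ∑ j ∈ Finset.range ((⨅ s, m s) + 1),
              DihedralGegenbauer.poch k j * DihedralGegenbauer.poch k j /
                  (DihedralGegenbauer.poch (2 * k) j * (j.factorial : ℝ)) *
                (-(2 : ℝ) ^ (2 - (n : ℤ)) * Real.sin (n * θ) * Real.sin (n * φ)) ^ j *
                ∏ s : Fin n,
                  DihedralGegenbauer.poch (k + j) (m s - j) / ((m s - j).factorial : ℝ) *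
                    DihedralGegenbauer.b (θ - φ) n (s + 1) ^ (m s - j) ∧
      DihedralGegenbauer.S N n k 0 θ =
        2 ^ N / Real.Gamma ((n : ℝ) * k + (N : ℝ)) *
          ∑ m ∈ Finset.piAntidiag (Finset.univ : Finset (Fin n)) N,
            ∏ s : Fin n,
              DihedralGegenbauer.poch k (m s) *
                (DihedralGegenbauer.b θ n (s + 1) ^ m s / ((m s).factorial : ℝ)) :=
  theorem1_general n hn k
    (fun i => ((neg_nonpos.2 i.cast_nonneg).trans_lt (mul_pos two_pos hk)).ne') φ θ N
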